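/- Let $(\mathbb N,\times)$ be the multiplicative semigroup of positive integers and let $p_1<p_2<\cdots$ be the primes. Fix an integer $b\ge 2$ and put $V=\{0,1,\dots,b-1\}$. For $N=\prod_j p_j^{e_j}\in\mathbb N$ let $\phi(N)\in V^*$ be the finite word $\cdots\bar e_3\bar e_2\bar e_1$ obtained by concatenating the base-$b$ expansions $\bar e_j$ of the exponents $e_j$ (with $\bar e_j$ the empty word if $e_j=0$); for example, if $b=10$ then $\phi(7^{903}\cdot 5^2\cdot 2)=90321$. Let $\Lambda$ be a finite set. A sequence $x\in\Lambda^{\mathbb N}$ is called automatic with respect to $(\mathbb N,\times)$ and $b$ if there are a finite set $S$, a state $s_0\in S$, maps $\alpha_v:S\to S$ ($v\in V$) and a map $\omega:S\to\Lambda$ such that for every $N\in\mathbb N$ with $\phi(N)=v_nv_{n-1}\cdots v_0$, $$x(N)=\omega\bigl(\alpha_{v_0}\circ\alpha_{v_1}\circ\cdots\circ\alpha_{v_n}(s_0)\bigr)$$ (so $x(1)=\omega(s_0)$, since $\phi(1)$ is the empty word). A function $f:\mathbb N\to\mathbb R$ is strongly deterministic (with respect to $(\mathbb N,\times)$) if there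 exist an action of $(\mathbb N,\times)$ by continuous maps on a compact metric space $X$, with $1$ acting as the identity and with topological entropy zero, a continuous function $\varphi:X\to\mathbb R$ and a point $x_0\in X$ such that $f(N)=\varphi(N(x_0))$ for all $N\in\mathbb N$. Here the topological entropy is $\sup_\mu\sup_{\mathcal P} h(\mu,\mathcal P)$, with $\mu$ ranging over the invariant Borel probability measures on $X$, $\mathcal P$ over the finite Borel partitions of $X$, and $h(\mu,\mathcal P)=\lim_{n}\frac1{|F_n|}H\bigl(\mu,\bigvee_{N\in F_n}N^{-1}\mathcal P\bigr)$, where $H$ is Shannon entropy and the limit exists and has the same value for every Følner sequence $(F_n)$ in $(\mathbb N,\times)$. Proposition. If $x\in\Lambda^{\mathbb N}$ is automatic with respect to $(\mathbb N,\times)$ and $b$, then $x$ is strongly deterministic; that is, $\iota\circ x$ is strongly deterministic for every map $\iota:\Lambda\to\mathbb R$ (in particular for the inclusion if $\Lambda\subset\mathbb R$). As an example, the multiplicative Thue–Morse sequence $x\in\{0,1\}^{\mathbb N}$, defined with $b=2$ by $x(N)=1$ if and only if $\phi(N)$ has an odd number of $1$'s, is automatic with respect to $(\mathbb N,\times)$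 and $2$, and is therefore strongly deterministic. -/

import Mathlib

open Filter MeasureTheory
open scoped ENNReal Pointwise

/-- A Følner sequence in `G`: nonempty finite sets `F n` such that, for every nonempty finite
`K` and every `ε > 0`, the sets `F n` are eventually `(K, ε)`-invariant. -/
def IsFolnerSeq {G : Type*} [Monoid G] (F : ℕ → Finset G) : Prop :=
  open Classical in
  (∀ n, (F n).Nonempty) ∧
    ∀ K : Finset G, K.Nonempty → ∀ ε : ℝ, 0 < ε →
      ∀ᶠ n in atTop, ((symmDiff (K * F n) (F n)).card : ℝ) / ((F n).card : ℝ) ≤ ε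

/-- Shannon entropy (logarithms in base `2`) of the finite partition of `X` into the fibres of a
map `p : X → ι`. Empty fibres contribute `0`. -/
noncomputable def shannonEntropy {X ι : Type*} [MeasurableSpace X] [Fintype ι]
    (μ : Measure X) (p : X → ι) : ℝ :=
  - ∑ i, μ.real (p ⁻¹' {i}) * Real.logb 2 (μ.real (p ⁻¹' {i}))

/-- The join `⋁_{g ∈ F} g⁻¹ P` of the translates of the partition into the fibres of `p`:
it is the partition into the fibres of `x ↦ (p (g • x))_{g ∈ F}`. -/
def joinMap {G X ι : Type*} [Monoid G] [MulAction G X] (p : X → ι) (F : Finset G) :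
    X → (F → ι) :=
  fun x g => p ((g : G) • x)

/-- Dynamical entropy `h(μ, P)` of the finite partition into the fibres of `p : X → Fin k`: the
common value, for all Følner sequences `F` in `G`, of the limit of `H(μ, P^{F n}) / |F n|`. So
that nothing has to be known about the existence of that limit and its independence of `F`, it is
written as the largest upper limit; it vanishes iff the limit is `0` along every Følner sequence. -/
noncomputable def dynEntropy (G : Type*) {X : Type*} [Monoid G] [MulAction G X]
    [MeasurableSpace X] (μ : Measure X) {k : ℕ} (p : X → Fin k) : ℝ≥0∞ :=
  open Classical in
  ⨆ (F : ℕ → Finset G) (_ : IsFolnerSeq F),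
    limsup (fun n => ENNReal.ofReal
      (shannonEntropy μ (joinMap p (F n)) / ((F n).card : ℝ))) atTop

/-- Kolmogorov–Sinai entropy: the supremum of `h(μ, P)` over all finite measurable partitions. -/
noncomputable def ksEntropy (G : Type*) {X : Type*} [Monoid G] [MulAction G X]
    [MeasurableSpace X] (μ : Measure X) : ℝ≥0∞ :=
  ⨆ (k : ℕ) (p : X → Fin k) (_ : Measurable p), dynEntropy G μ p

/-- Topological entropy of a system `(X, G)`: the supremum of the Kolmogorov–Sinai entropies of
all `G`-invariant Borel probability measures on `X`. -/
noncomputable def topEntropy (G X : Type*) [Monoid G] [MulAction G X]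
    [MeasurableSpace X] : ℝ≥0∞ :=
  ⨆ (μ : Measure X) (_ : IsProbabilityMeasure μ) (_ : SMulInvariantMeasure G X μ), ksEntropy G μ

/-- `f : G → ℝ` is strongly deterministic: it is read along the orbit of a point `x` by a
continuous function `φ` on a compact metric space `X` on which `G` acts by continuous maps with
topological entropy zero. -/
def StronglyDeterministic {G : Type*} [Monoid G] (f : G → ℝ) : Prop :=
  ∃ (X : Type) (_ : MetricSpace X) (_ : CompactSpace X) (_ : MeasurableSpace X)
    (_ : BorelSpace X) (_ : MulAction G X) (_ : ContinuousConstSMul G X),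
    topEntropy G X = 0 ∧
      ∃ (φ : X → ℝ) (x : X), Continuous φ ∧ ∀ g : G, f g = φ (g • x)

/-- The word `φ(N) = ⋯ ē₃ ē₂ ē₁` (leftmost letter first), where `N = ∏ pⱼ ^ eⱼ` over the primes
`p₁ < p₂ < ⋯` and `ēⱼ` is the base-`b` expansion of `eⱼ`, which is empty if `eⱼ = 0`.
`Nat.digits` lists digits from the least significant one, hence the `reverse`. -/
def exponentWord (b : ℕ) (N : ℕ+) : List ℕ :=
  (((N : ℕ).primeFactors.sort (· ≤ ·)).flatMap
    fun p => Nat.digits b ((N : ℕ).factorization p)).reverse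

/-- `x : ℕ+ → Λ` is automatic with respect to `(ℕ, ×)` and `b`: with `φ(N) = v_n ⋯ v_0` one has
`x N = ω (α_{v_0} (⋯ (α_{v_n} s₀)))`. All letters are smaller than `b`, so only the maps `α v`
with `v < b` play a role. -/
def IsMulAutomatic (b : ℕ) {Λ : Type*} (x : ℕ+ → Λ) : Prop :=
  ∃ (S : Type) (_ : Finite S) (s₀ : S) (α : ℕ → S → S) (ω : S → Λ),
    ∀ N : ℕ+, x N = ω ((exponentWord b N).foldl (fun s v => α v s) s₀)

/-- The multiplicative Thue–Morse sequence: `1` if the binary word `φ(N)` has an odd number of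
letters `1`, and `0` otherwise. -/
def mulThueMorse (N : ℕ+) : Fin 2 :=
  if Odd ((exponentWord 2 N).count 1) then 1 else 0

/-! The prime 2 is the smallest prime, so for odd `m` the word of `2 ^ e * m` is the word of `m`
followed by the base-`b` digits of `e`. Along a progression `N, 2N, 4N, ...` the automaton therefore
starts from one fixed state and reads the digits of consecutive integers `f, f + 1, ...`. A window
of length `n = b ^ k` meets at most two values of the leading digits, so it is determined by `f`
modulo `n` and boundedly many states: there are only `O(n)` windows (`exists_finset_digitOrbits`).

Few windows in a single direction already force zero entropy. The configurations on `ℕ+` with only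
such windows form a compact invariant space containing the state sequence
(`automatonState_mem_windowShift`). A Følner set is tiled, up to a small boundary, by progressions
`{2 ^ i * t : i < n}` (`exists_tiling`); each tile costs at most the logarithm of the number of
windows, which is `o(n)`. Hence each coordinate partition has zero entropy
(`HasZeroEntropy.of_orbit`).

The passage to all Borel partitions uses the Pinsker algebra: the sets of zero entropy form a
σ-algebra, and it contains the coordinate cylinders, which generate (`topEntropy_windowShift`). -/

/-- `p` is a measurable partition: unions of its fibres are measurable. -/
def IsMeasurablePartition {X ι : Type*} [MeasurableSpace X] (p : X → ι) : Prop :=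
  ∀ T : Set ι, MeasurableSet (p ⁻¹' T)

namespace IsMeasurablePartition

variable {X ι κ : Type*} [MeasurableSpace X]

theorem of_singleton [Finite ι] {p : X → ι} (hp : ∀ i, MeasurableSet (p ⁻¹' {i})) :
    IsMeasurablePartition p := by
  intro T
  have : p ⁻¹' T = ⋃ i ∈ T, p ⁻¹' {i} := by ext; simp
  rw [this]
  exact MeasurableSet.biUnion (Set.toFinite T).countable fun i _ => hp i

theorem comp {p : X → ι} (hp : IsMeasurablePartition p) (f : ι → κ) :
    IsMeasurablePartition (fun x => f (p x)) :=
  fun T => hp (f ⁻¹' T)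

theorem prodMk [Finite ι] [Finite κ] {p : X → ι} {q : X → κ} (hp : IsMeasurablePartition p)
    (hq : IsMeasurablePartition q) : IsMeasurablePartition (fun x => (p x, q x)) := by
  refine of_singleton fun i => ?_
  convert (hp {i.1}).inter (hq {i.2}) using 1
  ext; simp [Prod.ext_iff]

theorem pi {J : Type*} [Finite J] [Finite ι] {q : J → X → ι}
    (hq : ∀ j, IsMeasurablePartition (q j)) : IsMeasurablePartition (fun x j => q j x) := by
  refine of_singleton fun i => ?_
  convert MeasurableSet.iInter fun j => hq j {i j} using 1
  ext; simp [funext_iff]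

theorem smul {G : Type*} [SMul G X] [MeasurableConstSMul G X] {p : X → ι}
    (hp : IsMeasurablePartition p) (g : G) : IsMeasurablePartition (fun x => p (g • x)) :=
  fun T => measurable_const_smul g (hp T)

end IsMeasurablePartition

/-! ### Gibbs' inequality -/

/-- This is `log t ≤ t - 1` at `t = b / a`, multiplied by `a`. The hypothesis `hab` (absolute
continuity) is needed because of the convention `log 0 = 0`. -/
theorem Real.negMulLog_add_mul_log_le {a b : ℝ} (ha : 0 ≤ a) (hb : 0 ≤ b) (hab : b = 0 → a = 0) :
    Real.negMulLog a + a * Real.log b ≤ b - a := by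
  rcases ha.eq_or_lt with rfl | ha
  · simpa using hb
  have hb' : 0 < b := hb.lt_of_ne fun h => ha.ne' (hab h.symm)
  have h := Real.log_le_sub_one_of_pos (div_pos hb' ha)
  rw [Real.log_div hb'.ne' ha.ne'] at h
  have h2 := mul_le_mul_of_nonneg_left h ha.le
  have h3 : a * (b / a - 1) = b - a := by field_simp
  rw [Real.negMulLog]
  linarith

/-- Gibbs' inequality. -/
theorem Real.sum_negMulLog_le {ι : Type*} [Fintype ι] {a b : ι → ℝ} (ha : ∀ i, 0 ≤ a i)
    (hb : ∀ i, 0 ≤ b i) (hab : ∀ i, b i = 0 → a i = 0) (hs : ∑ i, b i ≤ ∑ i, a i) :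
    ∑ i, Real.negMulLog (a i) ≤ - ∑ i, a i * Real.log (b i) := by
  have h := Finset.sum_le_sum fun i (_ : i ∈ Finset.univ) =>
    Real.negMulLog_add_mul_log_le (ha i) (hb i) (hab i)
  rw [Finset.sum_add_distrib, Finset.sum_sub_distrib] at h
  linarith

theorem Real.negMulLog_sum_le {ι : Type*} (s : Finset ι) {a : ι → ℝ} (ha : ∀ i, 0 ≤ a i) :
    Real.negMulLog (∑ i ∈ s, a i) ≤ ∑ i ∈ s, Real.negMulLog (a i) := by
  rw [Real.negMulLog, neg_mul, Finset.sum_mul, ← Finset.sum_neg_distrib]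
  refine Finset.sum_le_sum fun i hi => ?_
  rw [Real.negMulLog, neg_mul, neg_le_neg_iff]
  rcases (ha i).eq_or_lt with h | h
  · simp [← h]
  · exact mul_le_mul_of_nonneg_left
      (Real.log_le_log h (Finset.single_le_sum (fun j _ => ha j) hi)) h.le

/-! ### Shannon entropy of partitions -/

section Entropy

variable {X ι κ : Type*} [MeasurableSpace X] {μ : Measure X}

theorem measureReal_preimage_eq_sum [IsProbabilityMeasure μ] {p : X → ι}
    (hp : IsMeasurablePartition p) (s : Finset ι) :
    μ.real (p ⁻¹' s) = ∑ i ∈ s, μ.real (p ⁻¹' {i}) :=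
  (sum_measureReal_preimage_singleton s fun i _ => hp {i}).symm

variable [Fintype ι]

theorem shannonEntropy_eq (μ : Measure X) (p : X → ι) :
    shannonEntropy μ p = (∑ i, Real.negMulLog (μ.real (p ⁻¹' {i}))) / Real.log 2 := by
  rw [shannonEntropy, Finset.sum_div, ← Finset.sum_neg_distrib]
  refine Finset.sum_congr rfl fun i _ => ?_
  rw [Real.negMulLog, Real.logb]
  ring

theorem sum_measureReal_fibers [IsProbabilityMeasure μ] {p : X → ι}
    (hp : IsMeasurablePartition p) : ∑ i, μ.real (p ⁻¹' {i}) = 1 := by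
  rw [← measureReal_preimage_eq_sum hp]
  simp

theorem shannonEntropy_nonneg [IsProbabilityMeasure μ] (p : X → ι) : 0 ≤ shannonEntropy μ p := by
  rw [shannonEntropy_eq]
  exact div_nonneg (Finset.sum_nonneg fun i _ =>
    Real.negMulLog_nonneg measureReal_nonneg measureReal_le_one) (Real.log_nonneg one_le_two)

theorem measureReal_comp_fiber [IsProbabilityMeasure μ] [DecidableEq κ] {p : X → ι}
    (hp : IsMeasurablePartition p) (f : ι → κ) (j : κ) :
    μ.real ((fun x => f (p x)) ⁻¹' {j}) = ∑ i with f i = j, μ.real (p ⁻¹' {i}) := by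
  rw [← measureReal_preimage_eq_sum hp]
  congr 1
  ext; simp

variable [Fintype κ]

theorem shannonEntropy_comp_le [IsProbabilityMeasure μ] {p : X → ι}
    (hp : IsMeasurablePartition p) (f : ι → κ) :
    shannonEntropy μ (fun x => f (p x)) ≤ shannonEntropy μ p := by
  classical
  rw [shannonEntropy_eq, shannonEntropy_eq]
  refine div_le_div_of_nonneg_right ?_ (Real.log_nonneg one_le_two)
  rw [← Finset.sum_fiberwise (s := Finset.univ) (g := f)]
  refine Finset.sum_le_sum fun j _ => ?_
  rw [measureReal_comp_fiber hp]
  exact Real.negMulLog_sum_le _ fun i => measureReal_nonneg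

/-- The cross entropy of a partition against a function of one of its factors is computed in
the factor. -/
theorem sum_measureReal_fibers_mul [IsProbabilityMeasure μ] {p : X → ι}
    (hp : IsMeasurablePartition p) (f : ι → κ) (c : κ → ℝ) :
    ∑ i, μ.real (p ⁻¹' {i}) * c (f i) = ∑ j, μ.real ((fun x => f (p x)) ⁻¹' {j}) * c j := by
  classical
  rw [← Finset.sum_fiberwise (s := Finset.univ) (g := f)]
  refine Finset.sum_congr rfl fun j _ => ?_
  rw [measureReal_comp_fiber hp, Finset.sum_mul]
  refine Finset.sum_congr rfl fun i hi => ?_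
  rw [(Finset.mem_filter.1 hi).2]

/-- Subadditivity is Gibbs' inequality for the joint distribution against the product of its
marginals. -/
theorem shannonEntropy_pi_le [IsProbabilityMeasure μ] {J : Type*} [Fintype J] [DecidableEq J]
    {q : J → X → ι} (hq : ∀ j, IsMeasurablePartition (q j)) :
    shannonEntropy μ (fun x j => q j x) ≤ ∑ j, shannonEntropy μ (q j) := by
  have hr := IsMeasurablePartition.pi hq
  set a : (J → ι) → ℝ := fun i => μ.real ((fun x j => q j x) ⁻¹' {i}) with ha
  set m : J → ι → ℝ := fun j c => μ.real (q j ⁻¹' {c}) with hm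
  have hle : ∀ i j, a i ≤ m j (i j) := fun i j =>
    measureReal_mono fun x hx => by
      have hx : (fun j => q j x) = i := hx
      simp [← hx]
  have key : ∑ i, Real.negMulLog (a i) ≤ - ∑ i, a i * Real.log (∏ j, m j (i j)) := by
    refine Real.sum_negMulLog_le (fun i => measureReal_nonneg)
      (fun i => Finset.prod_nonneg fun j _ => measureReal_nonneg) (fun i hi => ?_) ?_
    · obtain ⟨j, -, hj⟩ := Finset.prod_eq_zero_iff.1 hi
      exact le_antisymm ((hle i j).trans hj.le) measureReal_nonneg
    · rw [sum_measureReal_fibers hr, ← Fintype.prod_sum]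
      exact (Finset.prod_eq_one fun j _ => sum_measureReal_fibers (hq j)).le
  have hlog : ∀ i, a i * Real.log (∏ j, m j (i j)) = ∑ j, a i * Real.log (m j (i j)) := by
    intro i
    -- The logarithm of the product splits only if every marginal is nonzero; where one vanishes, so
    -- does the weight `a i`.
    by_cases hi : a i = 0
    · simp [hi]
    · rw [Real.log_prod, Finset.mul_sum]
      intro j _ h0
      exact hi (le_antisymm ((hle i j).trans h0.le) measureReal_nonneg)
  simp_rw [shannonEntropy_eq]
  rw [← Finset.sum_div]
  refine div_le_div_of_nonneg_right (key.trans_eq ?_) (Real.log_nonneg one_le_two)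
  simp_rw [hlog]
  rw [Finset.sum_comm, ← Finset.sum_neg_distrib]
  refine Finset.sum_congr rfl fun j _ => ?_
  rw [sum_measureReal_fibers_mul hr (fun i => i j) (fun c => Real.log (m j c)),
    ← Finset.sum_neg_distrib]
  simp [Real.negMulLog, hm]

theorem shannonEntropy_prodMk_le [IsProbabilityMeasure μ] {p : X → ι} {q : X → κ}
    (hp : IsMeasurablePartition p) (hq : IsMeasurablePartition q) :
    shannonEntropy μ (fun x => (p x, q x)) ≤ shannonEntropy μ p + shannonEntropy μ q := by
  have hr := hp.prodMk hq
  set a : ι × κ → ℝ := fun i => μ.real ((fun x => (p x, q x)) ⁻¹' {i}) with ha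
  have hle₁ : ∀ i, a i ≤ μ.real (p ⁻¹' {i.1}) := fun i =>
    measureReal_mono fun x hx => by
      have hx : (p x, q x) = i := hx
      simp [← hx]
  have hle₂ : ∀ i, a i ≤ μ.real (q ⁻¹' {i.2}) := fun i =>
    measureReal_mono fun x hx => by
      have hx : (p x, q x) = i := hx
      simp [← hx]
  have key : ∑ i, Real.negMulLog (a i) ≤
      - ∑ i, a i * Real.log (μ.real (p ⁻¹' {i.1}) * μ.real (q ⁻¹' {i.2})) := by
    refine Real.sum_negMulLog_le (fun i => measureReal_nonneg)
      (fun i => mul_nonneg measureReal_nonneg measureReal_nonneg) (fun i hi => ?_) ?_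
    · rcases mul_eq_zero.1 hi with h | h
      · exact le_antisymm ((hle₁ i).trans h.le) measureReal_nonneg
      · exact le_antisymm ((hle₂ i).trans h.le) measureReal_nonneg
    · rw [sum_measureReal_fibers hr, Fintype.sum_prod_type]
      dsimp only
      rw [← Finset.sum_mul_sum, sum_measureReal_fibers hp, sum_measureReal_fibers hq, one_mul]
  have hlog : ∀ i, a i * Real.log (μ.real (p ⁻¹' {i.1}) * μ.real (q ⁻¹' {i.2})) =
      a i * Real.log (μ.real (p ⁻¹' {i.1})) + a i * Real.log (μ.real (q ⁻¹' {i.2})) := by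
    intro i
    by_cases hi : a i = 0
    · simp [hi]
    · rw [Real.log_mul, mul_add]
      · exact fun h => hi (le_antisymm ((hle₁ i).trans h.le) measureReal_nonneg)
      · exact fun h => hi (le_antisymm ((hle₂ i).trans h.le) measureReal_nonneg)
  simp_rw [shannonEntropy_eq]
  rw [← add_div]
  refine div_le_div_of_nonneg_right (key.trans_eq ?_) (Real.log_nonneg one_le_two)
  simp_rw [hlog]
  rw [Finset.sum_add_distrib,
    sum_measureReal_fibers_mul hr Prod.fst (fun c => Real.log (μ.real (p ⁻¹' {c}))),
    sum_measureReal_fibers_mul hr Prod.snd (fun c => Real.log (μ.real (q ⁻¹' {c})))]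
  simp only [Real.negMulLog, neg_mul, Finset.sum_neg_distrib, neg_add]

/-- Gibbs' inequality against the uniform distribution on `T`. -/
theorem shannonEntropy_le_logb_card [IsProbabilityMeasure μ] {p : X → ι}
    (hp : IsMeasurablePartition p) (T : Finset ι) (hT : ∀ x, p x ∈ T) :
    shannonEntropy μ p ≤ Real.logb 2 T.card := by
  classical
  have hz : ∀ i, i ∉ T → μ.real (p ⁻¹' {i}) = 0 := fun i hi => by
    have : p ⁻¹' {i} = ∅ := by
      ext x
      simp only [Set.mem_preimage, Set.mem_singleton_iff, Set.mem_empty_iff_false, iff_false]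
      rintro rfl
      exact hi (hT x)
    simp [this]
  have hne : T.Nonempty := by
    obtain ⟨x⟩ := μ.nonempty_of_neZero
    exact ⟨p x, hT x⟩
  have hc : (T.card : ℝ) ≠ 0 := by exact_mod_cast hne.card_pos.ne'
  have key : ∑ i, Real.negMulLog (μ.real (p ⁻¹' {i})) ≤
      - ∑ i, μ.real (p ⁻¹' {i}) * Real.log (if i ∈ T then (T.card : ℝ)⁻¹ else 0) := by
    refine Real.sum_negMulLog_le (fun i => measureReal_nonneg) (fun i => ?_) (fun i hi => ?_) ?_
    · split_ifs <;> positivity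
    · by_cases h : i ∈ T
      · simp [h, hne.ne_empty] at hi
      · exact hz i h
    · rw [sum_measureReal_fibers hp, ← Finset.sum_filter]
      simp [hc]
  rw [shannonEntropy_eq, Real.logb]
  refine div_le_div_of_nonneg_right (key.trans_eq ?_) (Real.log_nonneg one_le_two)
  have : ∀ i, μ.real (p ⁻¹' {i}) * Real.log (if i ∈ T then (T.card : ℝ)⁻¹ else 0) =
      μ.real (p ⁻¹' {i}) * (- Real.log T.card) := by
    intro i
    by_cases h : i ∈ T
    · simp [h]
    · simp [hz i h]
  simp_rw [this]
  rw [← Finset.sum_mul, sum_measureReal_fibers hp]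
  simp

theorem shannonEntropy_smul {G : Type*} [SMul G X] [SMulInvariantMeasure G X μ] {p : X → ι}
    (hp : IsMeasurablePartition p) (g : G) :
    shannonEntropy μ (fun x => p (g • x)) = shannonEntropy μ p := by
  have : ∀ i, μ.real ((fun x => p (g • x)) ⁻¹' {i}) = μ.real (p ⁻¹' {i}) := fun i => by
    rw [Measure.real, Measure.real, ← SMulInvariantMeasure.measure_preimage_smul g (hp {i})]
    rfl
  simp_rw [shannonEntropy, this]

theorem shannonEntropy_mem [IsProbabilityMeasure μ] {A : Set X} (hA : MeasurableSet A) :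
    shannonEntropy μ (fun x => x ∈ A) = Real.binEntropy (μ.real A) / Real.log 2 := by
  have h₁ : (fun x => x ∈ A) ⁻¹' {True} = A := by ext; simp
  have h₂ : (fun x => x ∈ A) ⁻¹' {False} = Aᶜ := by ext; simp
  rw [shannonEntropy_eq, Fintype.univ_Prop, Finset.sum_pair (by simp), h₁, h₂,
    probReal_compl_eq_one_sub hA, Real.binEntropy_eq_negMulLog_add_negMulLog_one_sub]

end Entropy

/-! ### Tiling finite sets by progressions in one direction -/

section Tiling

variable {G : Type*} [CommMonoid G]

theorem apply_pow_mul_eq_add {h : G} {v : G → ℕ} (hv : ∀ g, v (h * g) = v g + 1) (j : ℕ) (t : G) :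
    v (h ^ j * t) = v t + j := by
  induction j with
  | zero => simp
  | succ j ih => rw [pow_succ', mul_assoc, hv, ih]; omega

theorem exists_eq_pow_mul {h : G} {v : G → ℕ} (hv : ∀ g, v (h * g) = v g + 1)
    (hd : ∀ g, 0 < v g → ∃ g', g = h * g') (i : ℕ) (g : G) (hi : i ≤ v g) :
    ∃ t, g = h ^ i * t := by
  induction i with
  | zero => exact ⟨g, by simp⟩
  | succ i ih =>
    obtain ⟨t, rfl⟩ := ih (by omega)
    rw [apply_pow_mul_eq_add hv] at hi
    obtain ⟨t', rfl⟩ := hd t (by omega)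
    exact ⟨t', by rw [pow_succ, mul_assoc]⟩

variable [IsCancelMul G] [DecidableEq G]

/-- A finite set is covered by disjoint tiles `{h ^ i * t : i < n}` contained in it, up to a set
controlled by its boundaries in the directions `h ^ d`, `d < n`. Here `v` is the `h`-adic
valuation. -/
theorem exists_tiling {h : G} {v : G → ℕ} (hv : ∀ g, v (h * g) = v g + 1)
    (hd : ∀ g, 0 < v g → ∃ g', g = h * g') {n : ℕ} (hn : 0 < n) (F : Finset G) :
    ∃ T E : Finset G, T.card * n ≤ F.card ∧
      E.card ≤ ∑ d ∈ Finset.range n, (symmDiff ({h ^ d} * F) F).card ∧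
      ∀ g ∈ F, g ∈ E ∨ ∃ t ∈ T, ∃ i : Fin n, g = h ^ (i : ℕ) * t := by
  have hvi := apply_pow_mul_eq_add hv
  -- Tiles start at elements whose valuation is divisible by `n`, which makes them disjoint. The
  -- exceptional set consists of the `g` for which some `h ^ d * g`, or a quotient of `g` by some `h
  -- ^ d`, with `d < n`, is not in `F`.
  refine ⟨F.filter fun t => n ∣ v t ∧ ∀ i < n, h ^ i * t ∈ F,
    (Finset.range n).biUnion fun d => (F.filter fun g => h ^ d * g ∉ F) ∪ (F \ ({h ^ d} * F)),
    ?_, ?_, ?_⟩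
  · rw [← Finset.card_range n, ← Finset.card_product]
    refine Finset.card_le_card_of_injOn (fun x => h ^ x.2 * x.1) ?_ ?_
    · rintro ⟨t, i⟩ hx
      simp only [Finset.coe_product, Set.mem_prod, Finset.mem_coe, Finset.mem_filter,
        Finset.mem_range, Finset.card_range] at hx
      exact hx.1.2.2 i hx.2
    · rintro ⟨t, i⟩ hx ⟨t', i'⟩ hx' heq
      simp only [Finset.coe_product, Set.mem_prod, Finset.mem_coe, Finset.mem_filter,
        Finset.mem_range, Finset.card_range] at hx hx' heq
      -- The valuation modulo `n` recovers the position inside the tile.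
      have h1 := congrArg (fun g => v g % n) heq
      obtain ⟨⟨-, ⟨a, ha⟩, -⟩, hi⟩ := hx
      obtain ⟨⟨-, ⟨a', ha'⟩, -⟩, hi'⟩ := hx'
      simp only [hvi, ha, ha', Nat.mul_add_mod, Nat.mod_eq_of_lt hi, Nat.mod_eq_of_lt hi'] at h1
      subst h1
      rw [mul_left_cancel heq]
  · refine Finset.card_biUnion_le.trans (Finset.sum_le_sum fun d _ => ?_)
    refine (Finset.card_union_le _ _).trans ?_
    rw [symmDiff_def, Finset.sup_eq_union, Finset.card_union_of_disjoint disjoint_sdiff_sdiff]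
    refine Nat.add_le_add_right ?_ _
    -- Translation by `h ^ d` carries the elements leaving `F` injectively into `h ^ d F \ F`, the
    -- other half of the symmetric difference.
    refine Finset.card_le_card_of_injOn (fun g => h ^ d * g) ?_
      fun g _ g' _ heq => mul_left_cancel heq
    intro g hg
    simp only [Finset.coe_filter, Set.mem_ofPred_eq] at hg
    simp only [Finset.coe_sdiff, Set.mem_sdiff, Finset.mem_coe]
    exact ⟨Finset.mul_mem_mul (Finset.mem_singleton_self _) hg.1, hg.2⟩
  · intro g hg
    by_cases hE : g ∈ (Finset.range n).biUnion fun d =>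
      (F.filter fun g => h ^ d * g ∉ F) ∪ (F \ ({h ^ d} * F))
    · exact Or.inl hE
    refine Or.inr ?_
    have hmul : ∀ d < n, h ^ d * g ∈ F := fun d hdn => by
      by_contra hc
      exact hE (Finset.mem_biUnion.2 ⟨d, Finset.mem_range.2 hdn,
        Finset.mem_union_left _ (Finset.mem_filter.2 ⟨hg, hc⟩)⟩)
    have hdiv : ∀ d < n, ∀ t, g = h ^ d * t → t ∈ F := fun d hdn t hgt => by
      by_contra hc
      refine hE (Finset.mem_biUnion.2 ⟨d, Finset.mem_range.2 hdn,
        Finset.mem_union_right _ (Finset.mem_sdiff.2 ⟨hg, fun hm => ?_⟩)⟩)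
      obtain ⟨a, ha, b, hb, hab⟩ := Finset.mem_mul.1 hm
      rw [Finset.mem_singleton.1 ha, hgt] at hab
      exact hc (mul_left_cancel hab ▸ hb)
    -- The tile of `g` starts at `g` divided by `h ^ (v g % n)`; its other elements are reached from
    -- `g` by fewer than `n` steps up or down.
    have hi := Nat.mod_lt (v g) hn
    obtain ⟨t, ht⟩ := exists_eq_pow_mul hv hd (v g % n) g (Nat.mod_le _ _)
    refine ⟨t, Finset.mem_filter.2 ⟨hdiv _ hi t ht, ?_, fun j hj => ?_⟩, ⟨v g % n, hi⟩, ht⟩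
    · have h1 := hvi (v g % n) t
      rw [← ht] at h1
      have h2 := Nat.mod_add_div (v g) n
      exact ⟨v g / n, by omega⟩
    · rcases le_total (v g % n) j with hij | hij
      · obtain ⟨k, rfl⟩ := Nat.exists_eq_add_of_le hij
        have := hmul k (by omega)
        rwa [ht, ← mul_assoc, ← pow_add, add_comm] at this
      · obtain ⟨k, hk⟩ := Nat.exists_eq_add_of_le hij
        refine hdiv k (by omega) _ ?_
        rw [← mul_assoc, ← pow_add, add_comm, ← hk]
        exact ht

end Tiling

/-! ### Partitions of zero entropy and the Pinsker algebra -/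

section ZeroEntropy

variable {G X ι κ : Type*} [Monoid G] [MulAction G X] [MeasurableSpace X] {μ : Measure X}

theorem IsMeasurablePartition.joinMap [MeasurableConstSMul G X] [Finite ι] {p : X → ι}
    (hp : IsMeasurablePartition p) (F : Finset G) : IsMeasurablePartition (joinMap p F) :=
  .pi fun g : F => hp.smul (g : G)

variable [Fintype ι] [Fintype κ]

/-- The entropy of the joins of `p` grows sublinearly along every Følner sequence. -/
def HasZeroEntropy (G : Type*) {X ι : Type*} [Monoid G] [MulAction G X] [MeasurableSpace X]
    (μ : Measure X) [Fintype ι] (p : X → ι) : Prop :=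
  open Classical in
  ∀ F : ℕ → Finset G, IsFolnerSeq F →
    Tendsto (fun n => shannonEntropy μ (joinMap p (F n)) / ((F n).card : ℝ)) atTop (nhds 0)

theorem IsFolnerSeq.card_pos {F : ℕ → Finset G} (hF : IsFolnerSeq F) (n : ℕ) :
    0 < ((F n).card : ℝ) := by
  exact_mod_cast (hF.1 n).card_pos

open Classical in
theorem HasZeroEntropy.eventually_le {p : X → ι} (h : HasZeroEntropy G μ p)
    {F : ℕ → Finset G} (hF : IsFolnerSeq F) {ε : ℝ} (hε : 0 < ε) :
    ∀ᶠ n in atTop, shannonEntropy μ (joinMap p (F n)) ≤ (F n).card * ε := by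
  filter_upwards [(h F hF).eventually_le_const hε] with n hn
  rw [div_le_iff₀ (hF.card_pos n)] at hn
  linarith

variable [IsProbabilityMeasure μ]

open Classical in
theorem HasZeroEntropy.of_eventually_le {p : X → ι}
    (h : ∀ F : ℕ → Finset G, IsFolnerSeq F → ∀ ε : ℝ, 0 < ε →
      ∀ᶠ n in atTop, shannonEntropy μ (joinMap p (F n)) ≤ (F n).card * ε) :
    HasZeroEntropy G μ p := by
  intro F hF
  refine tendsto_order.2 ⟨fun a ha => ?_, fun a ha => ?_⟩
  · exact Eventually.of_forall fun n =>
      ha.trans_le (div_nonneg (shannonEntropy_nonneg _) (hF.card_pos n).le)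
  · filter_upwards [h F hF (a / 2) (half_pos ha)] with n hn
    refine lt_of_le_of_lt ?_ (half_lt_self ha)
    rw [div_le_iff₀ (hF.card_pos n)]
    linarith

variable [MeasurableConstSMul G X]

open Classical in
theorem shannonEntropy_joinMap_comp_le {p : X → ι} (hp : IsMeasurablePartition p) (f : ι → κ)
    (F : Finset G) :
    shannonEntropy μ (joinMap (fun x => f (p x)) F) ≤ shannonEntropy μ (joinMap p F) :=
  shannonEntropy_comp_le (hp.joinMap F) fun i g => f (i g)

open Classical in
theorem shannonEntropy_joinMap_prodMk_le {p : X → ι} {q : X → κ}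
    (hp : IsMeasurablePartition p) (hq : IsMeasurablePartition q) (F : Finset G) :
    shannonEntropy μ (joinMap (fun x => (p x, q x)) F) ≤
      shannonEntropy μ (joinMap p F) + shannonEntropy μ (joinMap q F) :=
  (shannonEntropy_comp_le ((hp.joinMap F).prodMk (hq.joinMap F)) fun i g => (i.1 g, i.2 g)).trans
    (shannonEntropy_prodMk_le (hp.joinMap F) (hq.joinMap F))

open Classical in
theorem shannonEntropy_joinMap_le [SMulInvariantMeasure G X μ] {p : X → ι}
    (hp : IsMeasurablePartition p) (F : Finset G) :
    shannonEntropy μ (joinMap p F) ≤ F.card * shannonEntropy μ p := by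
  refine (shannonEntropy_pi_le fun g : F => hp.smul (g : G)).trans_eq ?_
  simp [shannonEntropy_smul hp]

theorem HasZeroEntropy.comp {p : X → ι} (h : HasZeroEntropy G μ p)
    (hp : IsMeasurablePartition p) (f : ι → κ) : HasZeroEntropy G μ (fun x => f (p x)) :=
  .of_eventually_le fun _ hF _ hε => (h.eventually_le hF hε).mono fun _ hn =>
    (shannonEntropy_joinMap_comp_le hp f _).trans hn

theorem HasZeroEntropy.pi {J : Type*} [Fintype J] [DecidableEq J] {q : J → X → ι}
    (h : ∀ j, HasZeroEntropy G μ (q j)) (hq : ∀ j, IsMeasurablePartition (q j)) :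
    HasZeroEntropy G μ (fun x j => q j x) := by
  classical
  refine .of_eventually_le fun F hF ε hε => ?_
  -- The `+ 1` keeps the divisor positive when `J` is empty.
  have hJ : (0 : ℝ) < Fintype.card J + 1 := by positivity
  filter_upwards [eventually_all.2 fun j => (h j).eventually_le hF (div_pos hε hJ)] with n hn
  refine (shannonEntropy_comp_le (.pi fun j => (hq j).joinMap (F n)) fun i g j => i j g).trans ?_
  refine (shannonEntropy_pi_le fun j => (hq j).joinMap (F n)).trans ?_
  refine (Finset.sum_le_sum fun j _ => hn j).trans ?_
  rw [Finset.sum_const, nsmul_eq_mul, Finset.card_univ, mul_left_comm]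
  refine mul_le_mul_of_nonneg_left ?_ (Nat.cast_nonneg _)
  rw [mul_div_assoc', div_le_iff₀ hJ]
  nlinarith

/-- A partition has zero entropy if, up to a partition of arbitrarily small entropy, it is
determined by partitions of zero entropy. -/
theorem HasZeroEntropy.of_approx [SMulInvariantMeasure G X μ] {r : X → ι}
    (h : ∀ ε : ℝ, 0 < ε → ∃ (m : ℕ) (p : X → Fin m → κ) (e : X → κ) (f : (Fin m → κ) × κ → ι),
      HasZeroEntropy G μ p ∧ IsMeasurablePartition p ∧ IsMeasurablePartition e ∧
      shannonEntropy μ e ≤ ε ∧ r = fun x => f (p x, e x)) :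
    HasZeroEntropy G μ r := by
  refine .of_eventually_le fun F hF ε hε => ?_
  obtain ⟨m, p, e, f, hp0, hp, he, hle, rfl⟩ := h (ε / 2) (half_pos hε)
  filter_upwards [hp0.eventually_le hF (half_pos hε)] with n hn
  refine (shannonEntropy_joinMap_comp_le (hp.prodMk he) f (F n)).trans ?_
  refine (shannonEntropy_joinMap_prodMk_le hp he (F n)).trans ?_
  have := (shannonEntropy_joinMap_le he (F n)).trans
    (mul_le_mul_of_nonneg_left hle (Nat.cast_nonneg (F n).card))
  linarith

theorem HasZeroEntropy.compl {A : Set X} (hA : MeasurableSet A)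
    (h : HasZeroEntropy G μ (fun x => x ∈ A)) : HasZeroEntropy G μ (fun x => x ∈ Aᶜ) :=
  h.comp (fun _ => (measurable_mem.2 hA) trivial) Not

/-- Membership in the union is determined by membership in the first `m` sets and in the tail `E m`.
The tails decrease to the empty set, so their measures, and by continuity of the binary entropy the
entropies of their indicators, tend to `0`. -/
theorem HasZeroEntropy.iUnion [SMulInvariantMeasure G X μ] {A : ℕ → Set X}
    (hA : ∀ i, MeasurableSet (A i)) (h : ∀ i, HasZeroEntropy G μ (fun x => x ∈ A i)) :
    HasZeroEntropy G μ (fun x => x ∈ ⋃ i, A i) := by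
  have hm : ∀ B : Set X, MeasurableSet B → IsMeasurablePartition (fun x => x ∈ B) :=
    fun B hB _ => (measurable_mem.2 hB) trivial
  set E : ℕ → Set X := fun m => (⋃ i, A i) \ ⋃ i < m, A i with hE
  have hEm : ∀ m, MeasurableSet (E m) := fun m =>
    (MeasurableSet.iUnion hA).diff (MeasurableSet.biUnion (Set.to_countable _) fun i _ => hA i)
  have hlim : Tendsto (fun m => shannonEntropy μ (fun x => x ∈ E m)) atTop (nhds 0) := by
    have h1 : Tendsto (μ ∘ E) atTop (nhds (μ (⋂ m, E m))) := by
      refine tendsto_measure_iInter_atTop (fun m => (hEm m).nullMeasurableSet) ?_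
        ⟨0, measure_ne_top _ _⟩
      intro m m' hmm x hx
      refine ⟨hx.1, fun hc => hx.2 ?_⟩
      simp only [Set.mem_iUnion] at hc ⊢
      obtain ⟨i, hi, hxi⟩ := hc
      exact ⟨i, hi.trans_le hmm, hxi⟩
    have h2 : ⋂ m, E m = ∅ := by
      ext x
      simp only [Set.mem_iInter, Set.mem_empty_iff_false, iff_false]
      intro hx
      obtain ⟨i, hi⟩ := Set.mem_iUnion.1 (hx 0).1
      exact (hx (i + 1)).2 (Set.mem_biUnion (Nat.lt_succ_self i) hi)
    rw [h2, measure_empty] at h1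
    have h3 : Tendsto (fun m => μ.real (E m)) atTop (nhds 0) := by
      exact (ENNReal.tendsto_toReal ENNReal.zero_ne_top).comp h1
    have h4 := ((Real.binEntropy_continuous.tendsto 0).comp h3).div_const (Real.log 2)
    simp only [Real.binEntropy_zero, zero_div] at h4
    exact h4.congr fun m => (shannonEntropy_mem (hEm m)).symm
  refine .of_approx (κ := Prop) fun ε hε => ?_
  obtain ⟨m, hmε⟩ := (hlim.eventually_le_const hε).exists
  refine ⟨m, fun x i => x ∈ A i, fun x => x ∈ E m, fun y => (∃ i, y.1 i) ∨ y.2,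
    .pi (fun i => h i) (fun i => hm _ (hA i)), .pi fun i => hm _ (hA i), hm _ (hEm m), hmε, ?_⟩
  ext x
  constructor
  · intro hx
    by_cases hc : x ∈ ⋃ i < m, A i
    · simp only [Set.mem_iUnion] at hc
      obtain ⟨i, hi, hxi⟩ := hc
      exact Or.inl ⟨⟨i, hi⟩, hxi⟩
    · exact Or.inr ⟨hx, hc⟩
  · rintro (⟨i, hi⟩ | hx)
    · exact Set.mem_iUnion.2 ⟨i, hi⟩
    · exact hx.1

theorem HasZeroEntropy.const (k : ι) : HasZeroEntropy G μ (fun _ : X => k) := by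
  classical
  refine .of_eventually_le fun F hF ε hε => Eventually.of_forall fun n => ?_
  refine (shannonEntropy_le_logb_card (IsMeasurablePartition.joinMap (fun T => .const (k ∈ T)) _)
    {fun _ => k} fun x => Finset.mem_singleton_self _).trans ?_
  simp only [Finset.card_singleton, Nat.cast_one, Real.logb_one]
  positivity

/-- The Pinsker `σ`-algebra: the measurable sets `A` for which `{A, Aᶜ}` has zero entropy. -/
abbrev pinskerAlgebra (G : Type*) {X : Type*} [Monoid G] [MulAction G X] [MeasurableSpace X]
    (μ : Measure X) [IsProbabilityMeasure μ] [MeasurableConstSMul G X]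
    [SMulInvariantMeasure G X μ] : MeasurableSpace X where
  MeasurableSet' A := MeasurableSet A ∧ HasZeroEntropy G μ (fun x => x ∈ A)
  measurableSet_empty := ⟨.empty, .const False⟩
  measurableSet_compl _ hA := ⟨hA.1.compl, hA.2.compl hA.1⟩
  measurableSet_iUnion _ hA := ⟨.iUnion fun i => (hA i).1, .iUnion (fun i => (hA i).1)
    fun i => (hA i).2⟩

theorem HasZeroEntropy.of_fibers [DecidableEq ι] {p : X → ι} (hp : IsMeasurablePartition p)
    (h : ∀ i, HasZeroEntropy G μ (fun x => x ∈ p ⁻¹' {i})) : HasZeroEntropy G μ p := by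
  classical
  obtain ⟨x₀⟩ := μ.nonempty_of_neZero
  have := (HasZeroEntropy.pi h fun i T => (measurable_mem.2 (hp {i})) trivial).comp
    (.pi fun i T => (measurable_mem.2 (hp {i})) trivial)
    -- The value of `p` is read off from the indicators of its fibres; `p x₀` is a default for
    -- patterns that never occur.
    (fun s : ι → Prop => if hs : ∃ i, s i then hs.choose else p x₀)
  convert this using 2 with x
  have hs : ∃ i, x ∈ p ⁻¹' {i} := ⟨p x, rfl⟩
  rw [dif_pos hs]
  exact hs.choose_spec

theorem topEntropy_eq_zero
    (h : ∀ (μ : Measure X) [IsProbabilityMeasure μ] [SMulInvariantMeasure G X μ],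
      ‹MeasurableSpace X› ≤ pinskerAlgebra G μ) : topEntropy G X = 0 := by
  simp only [topEntropy, ksEntropy, dynEntropy, ENNReal.iSup_eq_zero]
  intro μ _ _ k p hp F hF
  have hz : HasZeroEntropy G μ p := .of_fibers (fun T => hp trivial)
    fun i => (h μ _ (hp (MeasurableSet.singleton i))).2
  have := ENNReal.tendsto_ofReal (hz F hF)
  rw [ENNReal.ofReal_zero] at this
  exact this.limsup_eq

end ZeroEntropy

/-! ### Zero entropy from the orbits in one direction -/

section Orbit

variable {G X ι : Type*} [CommMonoid G] [MulAction G X] [MeasurableSpace X]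
  {μ : Measure X} [Fintype ι] [IsProbabilityMeasure μ] [MeasurableConstSMul G X]
  [SMulInvariantMeasure G X μ]

open Classical in
-- Each coordinate in `F` is either read directly on `E` or found in the window of a tile, so the
-- join over `F` is a function of the windows on `T` and the join over `E`.
theorem shannonEntropy_joinMap_le_of_cover {p : X → ι} (hp : IsMeasurablePartition p) (h : G)
    {n : ℕ} {F T E : Finset G}
    (hF : ∀ g ∈ F, g ∈ E ∨ ∃ t ∈ T, ∃ i : Fin n, g = h ^ (i : ℕ) * t) :
    shannonEntropy μ (joinMap p F) ≤
      T.card * shannonEntropy μ (fun x (i : Fin n) => p (h ^ (i : ℕ) • x)) +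
      E.card * shannonEntropy μ p := by
  have ho : IsMeasurablePartition (fun x (i : Fin n) => p (h ^ (i : ℕ) • x)) :=
    .pi fun i : Fin n => hp.smul (h ^ (i : ℕ))
  have hF' : ∀ g : F, (g : G) ∉ E → ∃ (t : T) (i : Fin n), (g : G) = h ^ (i : ℕ) * t :=
    fun g hg => by
      obtain ⟨t, ht, i, hi⟩ := (hF g g.2).resolve_left hg
      exact ⟨⟨t, ht⟩, i, hi⟩
  choose t i hti using hF'
  refine le_trans ?_ (add_le_add (shannonEntropy_joinMap_le ho T) (shannonEntropy_joinMap_le hp E))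
  refine le_trans (le_of_eq ?_) ((shannonEntropy_comp_le ((ho.joinMap T).prodMk (hp.joinMap E))
    (fun (y : (T → Fin n → ι) × (E → ι)) (g : F) =>
      if hg : (g : G) ∈ E then y.2 ⟨g, hg⟩ else y.1 (t g hg) (i g hg))).trans
    (shannonEntropy_prodMk_le (ho.joinMap T) (hp.joinMap E)))
  congr 1
  ext x g
  by_cases hg : (g : G) ∈ E
  · simp [joinMap, hg]
  · simp only [joinMap, hg, dite_false, smul_smul, ← hti g hg]

/-- If the orbits under some `h : G` with an `h`-adic valuation have sublinear entropy then the
entropy vanishes. -/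
theorem HasZeroEntropy.of_orbit [IsCancelMul G] {h : G} {v : G → ℕ} (hv : ∀ g, v (h * g) = v g + 1)
    (hd : ∀ g, 0 < v g → ∃ g', g = h * g') {p : X → ι} (hp : IsMeasurablePartition p)
    (hlim : ∀ ε : ℝ, 0 < ε → ∃ n : ℕ, 0 < n ∧
      shannonEntropy μ (fun x (i : Fin n) => p (h ^ (i : ℕ) • x)) ≤ n * ε) :
    HasZeroEntropy G μ p := by
  classical
  refine .of_eventually_le fun F hF ε hε => ?_
  obtain ⟨n, hn, hle⟩ := hlim (ε / 2) (half_pos hε)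
  set H := shannonEntropy μ p with hH
  have hH0 : 0 ≤ H := shannonEntropy_nonneg p
  have hn0 : (0 : ℝ) < n := by exact_mod_cast hn
  -- Chosen so that the exceptional set, of size at most `n * δ * |F k|`, contributes at most `ε /
  -- 2` per element; `H + 1` avoids division by zero.
  set δ : ℝ := ε / 2 / (n * (H + 1)) with hδ
  have hδ0 : 0 < δ := by positivity
  filter_upwards [(Finset.range n).eventually_all.2 fun d _ =>
    hF.2 {h ^ d} (Finset.singleton_nonempty _) δ hδ0] with k hk
  obtain ⟨T, E, hT, hE, hcov⟩ := exists_tiling hv hd hn (F k)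
  have hc := hF.card_pos k
  have hE' : (E.card : ℝ) ≤ n * (δ * (F k).card) := by
    calc (E.card : ℝ) ≤ ∑ d ∈ Finset.range n, ((symmDiff ({h ^ d} * F k) (F k)).card : ℝ) := by
          exact_mod_cast hE
      _ ≤ ∑ d ∈ Finset.range n, δ * (F k).card := by
          refine Finset.sum_le_sum fun d hd => ?_
          have := hk d hd
          rwa [div_le_iff₀ hc] at this
      _ = n * (δ * (F k).card) := by simp
  have hT' : (T.card : ℝ) * n ≤ (F k).card := by exact_mod_cast hT
  refine (shannonEntropy_joinMap_le_of_cover hp h hcov).trans ?_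
  have h1 := mul_le_mul_of_nonneg_left hle (Nat.cast_nonneg (α := ℝ) T.card)
  have h2 : (T.card : ℝ) * (n * (ε / 2)) ≤ (F k).card * (ε / 2) := by
    rw [← mul_assoc]
    exact mul_le_mul_of_nonneg_right hT' (half_pos hε).le
  have h3 := mul_le_mul_of_nonneg_right hE' hH0
  have h4 : n * (δ * (F k).card) * H ≤ (F k).card * (ε / 2) := by
    have : n * δ * H ≤ ε / 2 := by
      rw [hδ]
      have : n * (ε / 2 / (n * (H + 1))) * H = ε / 2 * (H / (H + 1)) := by field_simp
      rw [this]
      exact mul_le_of_le_one_right (half_pos hε).le ((div_le_one (by positivity)).2 (by linarith))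
    nlinarith
  linarith

end Orbit

/-- The entropy depends only on the Borel structure and the action, so any compatible metric will
do. -/
theorem StronglyDeterministic.of_metrizable {G X : Type} [Monoid G] [TopologicalSpace X]
    [TopologicalSpace.MetrizableSpace X] [CompactSpace X] [MeasurableSpace X] [BorelSpace X]
    [MulAction G X] [ContinuousConstSMul G X] (hX : topEntropy G X = 0) {φ : X → ℝ}
    (hφ : Continuous φ) (x : X) : StronglyDeterministic (fun g : G => φ (g • x)) :=
  ⟨X, TopologicalSpace.metrizableSpaceMetric X, ‹_›, ‹_›, ‹_›, ‹_›, ‹_›, hX, φ, x, hφ, fun _ => rfl⟩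

/-! ### The space of configurations with prescribed windows -/

section WindowShift

variable {G S : Type} [CommMonoid G]

/-- The configurations `y : G → S` such that every finite window `(y (g * h ^ i))_{i < n}` of `y`
in direction `h` is an initial segment of a sequence in `W`. -/
def windowShift (h : G) (W : Set (ℕ → S)) : Set (G → S) :=
  {y | ∀ (g : G) (n : ℕ), ∃ w ∈ W, ∀ i < n, y (g * h ^ i) = w i}

variable {h : G} {W : Set (ℕ → S)}

/-- Translation preserves the window condition by commutativity: the window of `g • y` at `m` is the
window of `y` at `m * g`. -/
instance : MulAction G (windowShift h W) where
  smul g y := ⟨fun m => y.1 (m * g), fun m n => by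
    obtain ⟨w, hw, hi⟩ := y.2 (m * g) n
    exact ⟨w, hw, fun i hin => by
      simpa only [mul_right_comm] using hi i hin⟩⟩
  one_smul y := Subtype.ext (funext fun m => congrArg y.1 (mul_one m))
  mul_smul g g' y := Subtype.ext (funext fun m => congrArg y.1 (mul_assoc m g g').symm)

theorem windowShift.smul_apply (g : G) (y : windowShift h W) (m : G) :
    (g • y).1 m = y.1 (m * g) := rfl

variable [TopologicalSpace S] [DiscreteTopology S]

theorem isClosed_windowShift : IsClosed (windowShift h W) := by
  have : windowShift h W = ⋂ (g : G) (n : ℕ),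
      (fun (y : G → S) (i : Fin n) => y (g * h ^ (i : ℕ))) ⁻¹'
        {u | ∃ w ∈ W, ∀ i : Fin n, u i = w i} := by
    ext y
    simp [windowShift, Fin.forall_iff]
  rw [this]
  exact isClosed_iInter fun g => isClosed_iInter fun n =>
    (isClosed_discrete _).preimage (by fun_prop)

instance [Finite S] : CompactSpace (windowShift h W) :=
  isCompact_iff_compactSpace.1 isClosed_windowShift.isCompact

instance : ContinuousConstSMul G (windowShift h W) where
  continuous_const_smul g := continuous_induced_rng.2 <|
    continuous_pi fun m => (continuous_apply (m * g)).comp continuous_subtype_val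

variable [Finite S] [Countable G] [IsCancelMul G] [MeasurableSpace S] [BorelSpace S]

/-- A window shift has entropy zero if its windows grow subexponentially in number, provided the
direction `h` carries an `h`-adic valuation `v`. -/
theorem topEntropy_windowShift {v : G → ℕ} (hv : ∀ g, v (h * g) = v g + 1)
    (hd : ∀ g, 0 < v g → ∃ g', g = h * g')
    (hW : ∀ ε : ℝ, 0 < ε → ∃ n : ℕ, 0 < n ∧ ∃ T : Finset (Fin n → S),
      Real.logb 2 T.card ≤ n * ε ∧ ∀ w ∈ W, (fun i : Fin n => w i) ∈ T) :
    topEntropy G (windowShift h W) = 0 := by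
  classical
  cases nonempty_fintype S
  refine topEntropy_eq_zero fun μ _ _ => ?_
  have hcoord : ∀ m : G, HasZeroEntropy G μ (fun y : windowShift h W => y.1 m) ∧
      IsMeasurablePartition (fun y : windowShift h W => y.1 m) := by
    intro m
    have hmeas : IsMeasurablePartition (fun y : windowShift h W => y.1 m) := fun T =>
      ((measurable_pi_apply m).comp measurable_subtype_coe) (Set.toFinite T).measurableSet
    refine ⟨.of_orbit hv hd hmeas fun ε hε => ?_, hmeas⟩
    obtain ⟨n, hn, T, hT, hWT⟩ := hW ε hε
    refine ⟨n, hn, (shannonEntropy_le_logb_card (.pi fun i : Fin n => hmeas.smul (h ^ (i : ℕ))) T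
      fun y => ?_).trans hT⟩
    obtain ⟨w, hw, hi⟩ := y.2 m n
    convert hWT w hw using 2 with i
    exact hi i i.2
  -- The σ-algebra of the space is generated by the coordinates, so it lies in the Pinsker algebra
  -- once every coordinate is measurable for the latter.
  have key : @Measurable _ _ (pinskerAlgebra G μ) _ (fun y : windowShift h W => y.1) := by
    refine @measurable_pi_lambda _ _ _ (pinskerAlgebra G μ) _ _ fun m => ?_
    refine @measurable_to_countable' _ _ _ _ (pinskerAlgebra G μ) _ fun s => ?_
    exact ⟨(hcoord m).2 {s}, (hcoord m).1.comp (hcoord m).2 (· = s)⟩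
  exact key.comap_le

theorem stronglyDeterministic_of_windows {v : G → ℕ} (hv : ∀ g, v (h * g) = v g + 1)
    (hd : ∀ g, 0 < v g → ∃ g', g = h * g')
    (hW : ∀ ε : ℝ, 0 < ε → ∃ n : ℕ, 0 < n ∧ ∃ T : Finset (Fin n → S),
      Real.logb 2 T.card ≤ n * ε ∧ ∀ w ∈ W, (fun i : Fin n => w i) ∈ T)
    {y : G → S} (hy : y ∈ windowShift h W) (φ : S → ℝ) :
    StronglyDeterministic (fun g : G => φ (y g)) := by
  -- The observable reads the coordinate at `1`, since `(g • y) 1 = y g`.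
  have hφ : Continuous (fun z : windowShift h W => φ (z.1 1)) :=
    (continuous_of_discreteTopology (f := φ)).comp
      ((continuous_apply 1).comp continuous_subtype_val)
  have := StronglyDeterministic.of_metrizable (topEntropy_windowShift hv hd hW) hφ ⟨y, hy⟩
  simpa [windowShift.smul_apply] using this

end WindowShift

/-! ### Counting windows of consecutive digit expansions -/

section Digits

variable {S : Type*}

/-- The action on the states of the base-`b` expansion of `e`, most significant digit first. -/
def digitAct (b : ℕ) (α : ℕ → S → S) (e : ℕ) (s : S) : S :=
  (Nat.digits b e).foldr α s

/-- The action of the `k` lowest base-`b` digits of `r`, leading zeros included. -/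
def paddedDigitAct (b : ℕ) (α : ℕ → S → S) : ℕ → ℕ → S → S
  | 0, _, s => s
  | k + 1, r, s => α (r % b) (paddedDigitAct b α k (r / b) s)

variable {b : ℕ} (α : ℕ → S → S)

theorem digitAct_of_pos (hb : 2 ≤ b) {e : ℕ} (he : 0 < e) (s : S) :
    digitAct b α e s = α (e % b) (digitAct b α (e / b) s) := by
  rw [digitAct, Nat.digits_def' hb he, List.foldr_cons, digitAct]

/-- Positivity of `q` matters: the zeros that pad `r` to length `k` are genuine digits only behind a
nonzero leading part. -/
theorem digitAct_mul_pow_add (hb : 2 ≤ b) {q : ℕ} (hq : 0 < q) (k : ℕ) :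
    ∀ r < b ^ k, ∀ s : S,
      digitAct b α (q * b ^ k + r) s = paddedDigitAct b α k r (digitAct b α q s) := by
  induction k with
  | zero =>
    intro r hr s
    obtain rfl : r = 0 := by simpa using hr
    simp [paddedDigitAct]
  | succ k ih =>
    intro r hr s
    have hb0 : 0 < b := by omega
    have h1 : q * b ^ (k + 1) + r = r + b * (q * b ^ k) := by ring
    rw [digitAct_of_pos α hb (by positivity), paddedDigitAct, h1, Nat.add_mul_mod_self_left,
      Nat.add_mul_div_left _ _ hb0, add_comm, ih]
    rw [Nat.div_lt_iff_lt_mul hb0, ← pow_succ]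
    exact hr

/-- The orbit sequences of the states under consecutive exponents. -/
def digitOrbits (b : ℕ) (α : ℕ → S → S) : Set (ℕ → S) :=
  {w | ∃ f s, w = fun i => digitAct b α (f + i) s}

/-- With `f = q * n + r`, the numbers `f + i`, `i < n`, have leading part `q` or `q + 1`. If `q > 0`
the window depends on `r` and the two states reached after these parts; if `q = 0` there is no
padding, and it depends on `f = r` and the initial state. -/
theorem exists_finset_digitOrbits [Fintype S] (hb : 2 ≤ b) (k : ℕ) :
    ∃ T : Finset (Fin (b ^ k) → S),
      T.card ≤ b ^ k * (Fintype.card S + Fintype.card S * Fintype.card S) ∧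
      ∀ w ∈ digitOrbits b α, (fun i : Fin (b ^ k) => w i) ∈ T := by
  classical
  set n := b ^ k with hn
  have hn0 : 0 < n := by positivity
  let A : Fin n × (S ⊕ S × S) → Fin n → S := fun x i => match x.2 with
    | .inl s => digitAct b α (x.1 + i) s
    | .inr t => if (x.1 : ℕ) + i < n then paddedDigitAct b α k (x.1 + i) t.1
        else paddedDigitAct b α k (x.1 + i - n) t.2
  refine ⟨Finset.univ.image A, Finset.card_image_le.trans_eq (by simp), ?_⟩
  rintro _ ⟨f, s, rfl⟩
  rw [Finset.mem_image]
  have hr := Nat.mod_lt f hn0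
  have hf := Nat.mod_add_div' f n
  rcases Nat.eq_zero_or_pos (f / n) with hq | hq
  · refine ⟨(⟨f % n, hr⟩, .inl s), Finset.mem_univ _, funext fun i => ?_⟩
    rw [hq, zero_mul, add_zero] at hf
    simp only [A, hf]
  · refine ⟨(⟨f % n, hr⟩, .inr (digitAct b α (f / n) s, digitAct b α (f / n + 1) s)),
      Finset.mem_univ _, funext fun i => ?_⟩
    have hi := i.2
    simp only [A]
    split_ifs with hlt
    · rw [← digitAct_mul_pow_add α hb hq k _ hlt, ← hn]
      congr 1
      omega
    · rw [← digitAct_mul_pow_add α hb (Nat.succ_pos _) k _ (by omega), ← hn, Nat.succ_mul]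
      congr 1
      omega

theorem exists_logb_card_digitOrbits_le [Finite S] [Nonempty S] (hb : 2 ≤ b) {ε : ℝ}
    (hε : 0 < ε) :
    ∃ n : ℕ, 0 < n ∧ ∃ T : Finset (Fin n → S),
      Real.logb 2 T.card ≤ n * ε ∧ ∀ w ∈ digitOrbits b α, (fun i : Fin n => w i) ∈ T := by
  cases nonempty_fintype S
  obtain ⟨s₀⟩ := ‹Nonempty S›
  set C : ℕ := Fintype.card S + Fintype.card S * Fintype.card S with hC
  have hC0 : 0 < C := by have := Fintype.card_pos_iff.2 ⟨s₀⟩; omega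
  have hl2 : 0 < Real.log 2 := Real.log_pos one_lt_two
  -- Half of the budget goes to `log n` and half to `log C`; the factor `log 2` comes from base-2
  -- logarithms.
  have hc : 0 < ε * Real.log 2 / 2 := by positivity
  have h1 : ∀ᶠ x : ℝ in atTop, Real.log x ≤ ε * Real.log 2 / 2 * x := by
    filter_upwards [Real.isLittleO_log_id_atTop.bound hc, eventually_ge_atTop 0] with x hx hx0
    refine (le_abs_self _).trans ?_
    simpa [abs_of_nonneg hx0] using hx
  have h2 : ∀ᶠ x : ℝ in atTop, Real.log C ≤ ε * Real.log 2 / 2 * x :=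
    (tendsto_id.const_mul_atTop hc).eventually_ge_atTop _
  have hpow : Tendsto (fun k : ℕ => ((b ^ k : ℕ) : ℝ)) atTop atTop :=
    tendsto_natCast_atTop_atTop.comp (tendsto_pow_atTop_atTop_of_one_lt (by omega))
  obtain ⟨k, hk1, hk2⟩ := ((hpow.eventually h1).and (hpow.eventually h2)).exists
  have hn0 : 0 < b ^ k := by positivity
  obtain ⟨T, hT, hw⟩ := exists_finset_digitOrbits α hb k
  refine ⟨b ^ k, hn0, T, ?_, hw⟩
  have hTpos : 0 < T.card := Finset.card_pos.2 ⟨_, hw _ ⟨0, s₀, rfl⟩⟩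
  rw [Real.logb, div_le_iff₀ hl2]
  have h3 : Real.log T.card ≤ Real.log ((b ^ k : ℕ) * C : ℝ) :=
    Real.log_le_log (by exact_mod_cast hTpos) (by exact_mod_cast hT)
  rw [Real.log_mul (by exact_mod_cast hn0.ne') (by exact_mod_cast hC0.ne')] at h3
  linarith

end Digits

/-! ### Automatic sequences and the multiplicative Thue–Morse sequence -/

section Automatic

variable {S : Type*} {b : ℕ}

/-- As the smallest prime, 2 heads the sorted list of prime factors, hence its digits end the
reversed word. -/
theorem exponentWord_two_pow_mul (e : ℕ) {m : ℕ+} (hm : ¬ 2 ∣ (m : ℕ)) :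
    exponentWord b (2 ^ e * m) = exponentWord b m ++ (Nat.digits b e).reverse := by
  have hm0 : (m : ℕ) ≠ 0 := m.ne_zero
  have hfac : (2 ^ e * (m : ℕ)).factorization =
      Finsupp.single 2 e + (m : ℕ).factorization := by
    rw [Nat.factorization_mul (by positivity) hm0, Nat.Prime.factorization_pow Nat.prime_two]
  have h2 : (m : ℕ).factorization 2 = 0 := Nat.factorization_eq_zero_of_not_dvd hm
  have hne : ∀ p ∈ (m : ℕ).primeFactors, p ≠ 2 := by
    rintro p hp rfl
    exact hm (Nat.dvd_of_mem_primeFactors hp)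
  have hrest : (((m : ℕ).primeFactors.sort (· ≤ ·)).flatMap
      fun p => Nat.digits b ((2 ^ e * (m : ℕ)).factorization p)) =
      (((m : ℕ).primeFactors.sort (· ≤ ·)).flatMap
      fun p => Nat.digits b ((m : ℕ).factorization p)) := by
    refine List.flatMap_congr fun p hp => ?_
    have := hne p ((Finset.mem_sort _).1 hp)
    rw [hfac]
    simp [this.symm]
  -- For `e = 0` the prime 2 is absent from the list of factors, and its digit list is empty.
  rcases Nat.eq_zero_or_pos e with rfl | he
  · simp
  have hcoe : ((2 ^ e * m : ℕ+) : ℕ) = 2 ^ e * (m : ℕ) := by simp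
  rw [exponentWord, hcoe, Nat.primeFactors_mul (by positivity) hm0,
    Nat.primeFactors_prime_pow he.ne' Nat.prime_two, ← Finset.insert_eq, Finset.sort_insert,
    List.flatMap_cons, hrest, List.reverse_append, ← exponentWord]
  · congr 2
    rw [hfac]
    simp [h2]
  · exact fun p hp => (Nat.prime_of_mem_primeFactors hp).two_le
  · exact fun h => hne 2 h rfl

/-- The state of the automaton after reading the word of `N`. -/
def automatonState (b : ℕ) (α : ℕ → S → S) (s₀ : S) (N : ℕ+) : S :=
  (exponentWord b N).foldl (fun s v => α v s) s₀

theorem automatonState_two_pow_mul (α : ℕ → S → S) (s₀ : S) (e : ℕ) {m : ℕ+}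
    (hm : ¬ 2 ∣ (m : ℕ)) :
    automatonState b α s₀ (2 ^ e * m) = digitAct b α e (automatonState b α s₀ m) := by
  rw [automatonState, exponentWord_two_pow_mul e hm, List.foldl_append, List.foldl_reverse]
  rfl

/-- With `N = 2 ^ f * m` and `m` odd, `N * 2 ^ i = 2 ^ (f + i) * m`: every window reads consecutive
exponents from the state of `m`. -/
theorem automatonState_mem_windowShift {S : Type} (α : ℕ → S → S) (s₀ : S) :
    automatonState b α s₀ ∈ windowShift (2 : ℕ+) (digitOrbits b α) := by
  intro N n
  obtain ⟨f, m, hm, hN⟩ := Nat.exists_eq_pow_mul_and_not_dvd N.ne_zero 2 (by norm_num)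
  have hm0 : 0 < m := Nat.pos_of_ne_zero (by rintro rfl; simp at hm)
  lift m to ℕ+ using hm0
  have hN' : N = 2 ^ f * m := PNat.eq (by rw [PNat.mul_coe, PNat.pow_coe]; exact hN)
  refine ⟨_, ⟨f, automatonState b α s₀ m, rfl⟩, fun i _ => ?_⟩
  rw [hN', mul_right_comm, ← pow_add]
  exact automatonState_two_pow_mul α s₀ _ hm

theorem IsMulAutomatic.stronglyDeterministic (hb : 2 ≤ b) {Λ : Type*} {x : ℕ+ → Λ}
    (hx : IsMulAutomatic b x) (ι : Λ → ℝ) : StronglyDeterministic (fun N : ℕ+ => ι (x N)) := by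
  obtain ⟨S, _, s₀, α, ω, hxω⟩ := hx
  have : Nonempty S := ⟨s₀⟩
  let : TopologicalSpace S := ⊥
  have : DiscreteTopology S := ⟨rfl⟩
  borelize S
  have hv : ∀ N : ℕ+, ((2 * N : ℕ+) : ℕ).factorization 2 = (N : ℕ).factorization 2 + 1 := by
    intro N
    rw [PNat.mul_coe, Nat.factorization_mul (by simp) N.ne_zero]
    simp [Nat.prime_two.factorization_self, add_comm]
  have hd : ∀ N : ℕ+, 0 < (N : ℕ).factorization 2 → ∃ M : ℕ+, N = 2 * M := by
    intro N hN
    have : (2 : ℕ) ∣ N := Nat.dvd_of_factorization_pos hN.ne'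
    exact PNat.dvd_iff.2 this
  have := stronglyDeterministic_of_windows (v := fun N : ℕ+ => (N : ℕ).factorization 2) hv hd
    (fun ε hε => exists_logb_card_digitOrbits_le α hb hε)
    (automatonState_mem_windowShift α s₀) (fun s => ι (ω s))
  simp only [hxω]
  exact this

theorem isMulAutomatic_mulThueMorse : IsMulAutomatic 2 mulThueMorse := by
  refine ⟨Fin 2, inferInstance, 0, fun v s => if v = 1 then s + 1 else s, id, fun N => ?_⟩
  -- The state is the running parity in `Fin 2`; the initial state is left arbitrary for the
  -- induction.
  have key : ∀ (l : List ℕ) (s : Fin 2),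
      l.foldl (fun s v => if v = 1 then s + 1 else s) s =
        s + if Odd (l.count 1) then 1 else 0 := by
    intro l
    induction l with
    | nil => simp
    | cons a l ih =>
      intro s
      rw [List.foldl_cons, ih]
      by_cases ha : a = 1
      · subst ha
        simp only [if_true, List.count_cons_self, Nat.odd_add_one]
        by_cases h : Odd (l.count 1) 
        all_goals
          simp only [h, not_true, not_false_eq_true, if_true, if_false]
          revert s
          decide
      · simp [ha]
  rw [mulThueMorse, key]
  simp

end Automatic

theorem mainTheorem10 :
    (∀ b : ℕ, 2 ≤ b → ∀ (Λ : Type*) [Finite Λ] (x : ℕ+ → Λ), IsMulAutomatic b x →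
      ∀ ι : Λ → ℝ, StronglyDeterministic (fun N : ℕ+ => ι (x N))) ∧
    IsMulAutomatic 2 mulThueMorse ∧
    StronglyDeterministic (fun N : ℕ+ => ((mulThueMorse N : ℕ) : ℝ)) :=
  ⟨fun _ hb _ _ _ hx ι => hx.stronglyDeterministic hb ι, isMulAutomatic_mulThueMorse,
    isMulAutomatic_mulThueMorse.stronglyDeterministic le_rfl fun i => ((i : ℕ) : ℝ)⟩
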